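/- Let $k\ge 0$ and $n$ be integers with $m := n-2-k > 2$. Consider the linear regression model $Y = X\beta+\varepsilon$, where $X$ is a fixed real $n\times(2+k)$ matrix of full column rank (in the application its columns are the intercept, the $0/1$ group variable and $k$ further explanatory variables), $\beta=(\beta_0,\beta_1,\ldots,\beta_{1+k})'\in\mathbb{R}^{2+k}$, and $\varepsilon$ is an $n$-variate normal random vector with expectation vector $0$ and covariance matrix $\sigma^2 I_n$, $\sigma>0$. Let $$\widehat\beta=(X'X)^{-1}X'Y,\qquad \widehat\sigma^2=\frac1m\,(Y-X\widehat\beta)'(Y-X\widehat\beta),\qquad \widehat d=\frac{\widehat\beta_1}{\sqrt{\widehat\sigma^2}},$$ $$d=\frac{\beta_1}{\sigma},\qquad v_1^2=e'(X'X)^{-1}e,\qquad c(m)=\frac{\Gamma((m-1)/2)\,\sqrt{m/2}}{\Gamma(m/2)},$$ where $e\in\mathbb{R}^{2+k}$ is the unit vector at the position of $\beta_1$. Then $\widehat d$ has a finite second moment, and $$\mathrm{E}(\widehat d)=c(m)\,d,\qquad \mathrm{Var}(\widehat d)=\frac{m}{m-2}\,v_1^2+\left(\frac{m}{m-2}-c(m)^2\right)d^2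 .$$ -/

import Mathlib

open MeasureTheory ProbabilityTheory
open scoped Matrix

namespace CohenD

noncomputable section

/-- Residual degrees of freedom `m = n - 2 - k`, as a real number (no truncated subtraction). -/
def dof (n k : ℕ) : ℝ := (n : ℝ) - 2 - (k : ℝ)

/-- The least squares estimate `(X' X)⁻¹ X' y` of the parameter vector. -/
def betaHat {n k : ℕ} (X : Matrix (Fin n) (Fin (k + 2)) ℝ) (y : Fin n → ℝ) : Fin (k + 2) → ℝ :=
  ((Xᵀ * X)⁻¹ * Xᵀ) *ᵥ y

/-- The usual unbiased estimate `m⁻¹ (y - X β̂)' (y - X β̂)` of the error variance. -/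
def sigmaHatSq {n k : ℕ} (X : Matrix (Fin n) (Fin (k + 2)) ℝ) (y : Fin n → ℝ) : ℝ :=
  (dof n k)⁻¹ * ((y - X *ᵥ betaHat X y) ⬝ᵥ (y - X *ᵥ betaHat X y))

/-- The generalized Cohen estimate `β̂₁ / √(σ̂²)`. Parameters are indexed `0, 1, …, k + 1`,
index `0` being the intercept and index `1` the group variable. -/
def dHat {n k : ℕ} (X : Matrix (Fin n) (Fin (k + 2)) ℝ) (y : Fin n → ℝ) : ℝ :=
  betaHat X y 1 / √(sigmaHatSq X y)

/-- `v₁² = e' (X' X)⁻¹ e`, where `e` is the unit vector at the position of `β₁`. -/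
def v1Sq {n k : ℕ} (X : Matrix (Fin n) (Fin (k + 2)) ℝ) : ℝ :=
  (Pi.single 1 1 : Fin (k + 2) → ℝ) ⬝ᵥ ((Xᵀ * X)⁻¹ *ᵥ (Pi.single 1 1 : Fin (k + 2) → ℝ))

/-- The population effect size `d = β₁ / σ`. -/
def effectSize {k : ℕ} (β : Fin (k + 2) → ℝ) (σ : ℝ) : ℝ := β 1 / σ

/-- `c(m) = Γ((m - 1) / 2) √(m / 2) / Γ(m / 2)`. -/
def c (m : ℝ) : ℝ := Real.Gamma ((m - 1) / 2) * √(m / 2) / Real.Gamma (m / 2)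

end

end CohenD

/-!
Write `ε = σ Z` with `Z` standard Gaussian in `ℝⁿ`, and let `V` be the column space of `X`.
The residual vector `y - X β̂` is the orthogonal projection of `σ Z` on `Vᗮ` (`toLp_residual_eq`),
while `β̂₁ = β₁ + σ ⟪s, Z⟫` with `s = X (X' X)⁻¹ e ∈ V` and `‖s‖² = v₁²` (`betaHat_one_eq`,
`inner_slopeVec_self`). Hence, with `R` the projection of `Z` on `Vᗮ`,
`d̂ = √m (d + ⟪s, Z⟫) ‖R‖⁻¹` (`dHat_eq`).

As `s ⊥ Vᗮ`, the Gaussian variables `⟪s, Z⟫` and `R` are uncorrelated, hence independent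
(`indepFun_inner_orthogonalProjectionOnto`), and `R` is standard Gaussian in the `m`-dimensional
space `Vᗮ` (`stdGaussian_map_orthogonalProjectionOnto`). So the first two moments of `d̂ / √m` are
products of those of `d + ⟪s, Z⟫`, which has mean `d` and variance `v₁²`, and of `‖R‖⁻¹`.

The moments of `‖R‖` come from the density of the standard Gaussian measure
(`stdGaussian_eq_withDensity`): in polar coordinates the mean of `‖R‖ ^ p` is proportional to
`∫ r ^ (m - 1 + p) exp (- r² / 2) dr` over `r > 0`, and the case `p = 0` fixes the constant
(`integral_norm_rpow_stdGaussian`). The values `p = -1` and `p = -2` give `c(m) / √m` and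
`1 / (m - 2)`.
-/

namespace CohenD

/-! ### The standard Gaussian measure of a Euclidean space -/

section Gaussian

variable {E F : Type*} [NormedAddCommGroup E] [InnerProductSpace ℝ E] [FiniteDimensional ℝ E]
  [MeasurableSpace E] [BorelSpace E] [NormedAddCommGroup F] [InnerProductSpace ℝ F]
  [FiniteDimensional ℝ F] [MeasurableSpace F] [BorelSpace F]

lemma integrable_exp_neg_half_mul_sq_norm :
    Integrable (fun x : F ↦ Real.exp (-(1 / 2) * ‖x‖ ^ 2)) :=
  .of_integral_ne_zero <| by
    rw [GaussianFourier.integral_rexp_neg_mul_sq_norm (by norm_num)]; positivity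

/-- Both sides have the same characteristic function, by the formula for the Fourier transform of
`exp (- ‖x‖² / 2)`. -/
lemma stdGaussian_eq_withDensity :
    stdGaussian F = (volume : Measure F).withDensity fun x ↦ ENNReal.ofReal
      (((2 * Real.pi) ^ (Module.finrank ℝ F / 2 : ℝ))⁻¹ * Real.exp (-(1 / 2) * ‖x‖ ^ 2)) := by
  set C : ℝ := ((2 * Real.pi) ^ (Module.finrank ℝ F / 2 : ℝ))⁻¹ with hC
  have hint := (integrable_exp_neg_half_mul_sq_norm (F := F)).const_mul C
  have : IsFiniteMeasure ((volume : Measure F).withDensity fun x ↦ ENNReal.ofReal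
      (C * Real.exp (-(1 / 2) * ‖x‖ ^ 2))) := isFiniteMeasure_withDensity_ofReal hint.2
  refine Measure.ext_of_charFun ?_
  ext t
  rw [charFun_stdGaussian, charFun_apply,
    integral_withDensity_eq_integral_toReal_smul (by fun_prop) (by simp)]
  have h := GaussianFourier.integral_cexp_neg_mul_sq_norm_add (V := F) (b := 1 / 2) (by norm_num)
    Complex.I t
  have hC' : (C : ℂ) * (Real.pi / (1 / 2) : ℂ) ^ (Module.finrank ℝ F / 2 : ℂ) = 1 := by
    have h1 : (Real.pi / (1 / 2) : ℂ) ^ (Module.finrank ℝ F / 2 : ℂ)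
        = (((2 * Real.pi) ^ (Module.finrank ℝ F / 2 : ℝ) : ℝ) : ℂ) := by
      rw [Complex.ofReal_cpow (by positivity)]; push_cast; congr 1; ring
    rw [h1, ← Complex.ofReal_mul, hC, inv_mul_cancel₀ (by positivity), Complex.ofReal_one]
  calc Complex.exp (-‖t‖ ^ 2 / 2)
      = C * ∫ v : F, Complex.exp (-(1 / 2) * ‖v‖ ^ 2 + Complex.I * inner ℝ t v) := by
        rw [h, ← mul_assoc, hC', one_mul, Complex.I_sq]; congr 1; ring
    _ = _ := by
        rw [← integral_const_mul]
        congr 1 with x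
        rw [ENNReal.toReal_ofReal (by positivity), Complex.exp_add, Complex.real_smul,
          real_inner_comm, mul_comm Complex.I]
        push_cast; ring

/-! ### Moments of the norm of a standard Gaussian vector -/

lemma integral_norm_rpow_stdGaussian {p : ℝ} (hF : 0 < Module.finrank ℝ F)
    (hp : 0 < Module.finrank ℝ F + p) :
    ∫ x, ‖x‖ ^ p ∂stdGaussian F =
      2 ^ (p / 2) * Real.Gamma ((Module.finrank ℝ F + p) / 2) /
        Real.Gamma (Module.finrank ℝ F / 2) := by
  set m := Module.finrank ℝ F
  have hm' : (0 : ℝ) < m := by exact_mod_cast hF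
  -- The constant `K` does not depend on the exponent; `q = 0` determines it.
  obtain ⟨K, hK⟩ : ∃ K : ℝ, ∀ q : ℝ, 0 < m + q → ∫ x, ‖x‖ ^ q ∂stdGaussian F =
      K * (2 ^ (q / 2) * Real.Gamma ((m + q) / 2)) := by
    refine ⟨((2 * Real.pi) ^ (m / 2 : ℝ))⁻¹ * (m * (volume : Measure F).real (Metric.ball 0 1) *
      (2 ^ (m / 2 : ℝ) / 2)), fun q hq ↦ ?_⟩
    have : Nontrivial F := Module.nontrivial_of_finrank_pos hF
    rw [stdGaussian_eq_withDensity,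
      integral_withDensity_eq_integral_toReal_smul (by fun_prop) (by simp)]
    have h2 := integral_fun_norm_addHaar (volume : Measure F)
      (fun r : ℝ ↦ Real.exp (-(1 / 2) * r ^ 2) * r ^ q)
    have h3 : ∫ r in Set.Ioi (0 : ℝ), r ^ (m - 1) • (Real.exp (-(1 / 2) * r ^ 2) * r ^ q) =
        2 ^ (m / 2 : ℝ) / 2 * (2 ^ (q / 2) * Real.Gamma ((m + q) / 2)) := by
      have h4 := integral_rpow_mul_exp_neg_mul_rpow (p := 2) (q := m - 1 + q) (b := 1 / 2)
        (by norm_num) (by linarith) (by norm_num)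
      rw [show (m - 1 + q + 1 : ℝ) = m + q by ring] at h4
      rw [show ∀ y : ℝ, y / 2 * (2 ^ (q / 2) * Real.Gamma ((m + q) / 2)) =
        y * 2 ^ (q / 2) * (1 / 2) * Real.Gamma ((m + q) / 2) from fun y ↦ by ring,
        ← Real.rpow_add (by norm_num), ← add_div]
      rw [one_div, Real.inv_rpow (by norm_num), neg_div, Real.rpow_neg (by norm_num), inv_inv,
        ← one_div] at h4
      rw [← h4]
      refine setIntegral_congr_fun measurableSet_Ioi fun r (hr : 0 < r) ↦ ?_
      simp only [smul_eq_mul, Real.rpow_two]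
      rw [Real.rpow_add hr, ← Nat.cast_pred hF, Real.rpow_natCast]
      ring
    rw [h3] at h2
    simp only [smul_eq_mul, nsmul_eq_mul] at h2 ⊢
    rw [mul_assoc, mul_assoc _ _ (2 ^ (q / 2) * _), mul_assoc (m : ℝ), ← h2, ← integral_const_mul]
    congr 1 with x
    rw [ENNReal.toReal_ofReal (by positivity)]
    ring
  have h0 := hK 0 (by simpa using hm')
  simp only [Real.rpow_zero, integral_const, probReal_univ, smul_eq_mul, mul_one, zero_div,
    add_zero, one_mul] at h0
  have hG := Real.Gamma_pos_of_pos (half_pos hm')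
  rw [hK p hp, eq_div_iff hG.ne']
  linear_combination (-(2 ^ (p / 2) * Real.Gamma ((m + p) / 2))) * h0

/-- Integrability follows from the integral being nonzero. -/
lemma integrable_norm_rpow_stdGaussian {p : ℝ} (hF : 0 < Module.finrank ℝ F)
    (hp : 0 < Module.finrank ℝ F + p) :
    Integrable (fun x ↦ ‖x‖ ^ p) (stdGaussian F) := by
  refine .of_integral_ne_zero ?_
  rw [integral_norm_rpow_stdGaussian hF hp]
  have := Real.Gamma_pos_of_pos (half_pos hp)
  have := Real.Gamma_pos_of_pos (half_pos (Nat.cast_pos (α := ℝ).2 hF))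
  positivity

lemma memLp_inv_norm_stdGaussian (hF : 2 < Module.finrank ℝ F) :
    MemLp (fun x ↦ ‖x‖⁻¹) 2 (stdGaussian F) := by
  have hF' : (2 : ℝ) < Module.finrank ℝ F := by exact_mod_cast hF
  refine (memLp_two_iff_integrable_sq (by fun_prop)).2 ?_
  refine (integrable_norm_rpow_stdGaussian (F := F) (p := -2) (by lia) (by linarith)).congr
    (.of_forall fun x ↦ ?_)
  simp only [Real.rpow_neg (norm_nonneg x), Real.rpow_two, inv_pow]

lemma integral_inv_norm_sq_stdGaussian (hF : 2 < Module.finrank ℝ F) :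
    ∫ x, ‖x‖⁻¹ ^ 2 ∂stdGaussian F = (Module.finrank ℝ F - 2 : ℝ)⁻¹ := by
  have h := integral_norm_rpow_stdGaussian (F := F) (p := -2) (by lia)
    (by linarith [(Nat.ofNat_lt_cast (α := ℝ)).2 hF])
  set m := Module.finrank ℝ F
  have hm : (2 : ℝ) < m := by exact_mod_cast hF
  -- `Γ(m / 2) = ((m - 2) / 2) Γ((m - 2) / 2)`.
  have hG : Real.Gamma (m / 2 : ℝ) = (m + -2) / 2 * Real.Gamma ((m + -2) / 2) := by
    rw [← Real.Gamma_add_one (by linarith)]; congr 1; ring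
  have hpos := Real.Gamma_pos_of_pos (s := (m + -2 : ℝ) / 2) (by linarith)
  have hne : (m - 2 : ℝ) ≠ 0 := by linarith
  simp only [Real.rpow_neg (norm_nonneg _), Real.rpow_two] at h
  simp only [inv_pow]
  rw [h, hG, show (-2 / 2 : ℝ) = -1 by norm_num, Real.rpow_neg_one, ← sub_eq_add_neg] at *
  field_simp

/-- The factor `c(m)` is the mean of `√m / χ`, with `χ` the norm of a standard Gaussian vector in
dimension `m`. -/
lemma sqrt_mul_integral_inv_norm_stdGaussian (hF : 2 < Module.finrank ℝ F) :
    √(Module.finrank ℝ F) * ∫ x, ‖x‖⁻¹ ∂stdGaussian F = c (Module.finrank ℝ F) := by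
  have h := integral_norm_rpow_stdGaussian (F := F) (p := -1) (by lia)
    (by linarith [(Nat.ofNat_lt_cast (α := ℝ)).2 hF])
  simp only [Real.rpow_neg_one] at h
  rw [h, c, neg_div, Real.rpow_neg (by norm_num), ← Real.sqrt_eq_rpow, ← sub_eq_add_neg,
    Real.sqrt_div (Nat.cast_nonneg _)]
  ring

/-! ### Projections and linear forms of a standard Gaussian vector -/

lemma stdGaussian_map_orthogonalProjectionOnto (W : Submodule ℝ E) :
    (stdGaussian E).map W.orthogonalProjectionOnto = stdGaussian W := by
  refine Measure.ext_of_charFun ?_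
  ext t
  rw [charFun_apply, integral_map (by fun_prop) (by fun_prop), charFun_stdGaussian]
  simp_rw [Submodule.inner_orthogonalProjectionOnto_eq_of_mem_right]
  rw [← charFun_apply, charFun_stdGaussian, Submodule.coe_norm]

lemma covariance_inner_stdGaussian (a b : E) :
    cov[fun x ↦ inner ℝ a x, fun x ↦ inner ℝ b x; stdGaussian E] = inner ℝ a b := by
  rw [← covarianceBilin_apply_eq_cov IsGaussian.memLp_two_id, covarianceBilin_stdGaussian,
    innerSL_apply_apply]

lemma integral_inner_stdGaussian (a : E) : ∫ x, inner ℝ a x ∂stdGaussian E = 0 :=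
  integral_strongDual_stdGaussian (innerSL ℝ a)

lemma multivariateGaussian_zero_smul_one {ι : Type*} [Fintype ι] [DecidableEq ι] (σ : ℝ) :
    multivariateGaussian 0 (σ ^ 2 • (1 : Matrix ι ι ℝ)) =
      (stdGaussian (EuclideanSpace ℝ ι)).map (σ • ·) := by
  refine Measure.ext_of_charFun ?_
  ext t
  have h : t.ofLp ⬝ᵥ t.ofLp = ‖t‖ ^ 2 := by
    rw [← real_inner_self_eq_norm_sq, EuclideanSpace.inner_eq_star_dotProduct, star_trivial]
  rw [charFun_multivariateGaussian (Matrix.PosSemidef.one.smul (sq_nonneg σ)), charFun_map_smul,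
    charFun_stdGaussian, norm_smul, Matrix.smul_mulVec, Matrix.one_mulVec, dotProduct_smul, h,
    inner_zero_right, smul_eq_mul, ← Complex.ofReal_pow,
    mul_pow ‖σ‖, Real.norm_eq_abs, sq_abs]
  congr 1
  push_cast
  ring

/-- The two variables are jointly Gaussian and uncorrelated. -/
lemma indepFun_inner_orthogonalProjectionOnto {Ω : Type*} [MeasurableSpace Ω] {P : Measure Ω}
    {Z : Ω → E} (hZ : HasLaw Z (stdGaussian E) P) (W : Submodule ℝ E) {a : E} (ha : a ∈ Wᗮ) :
    IndepFun (fun ω ↦ inner ℝ a (Z ω)) (fun ω ↦ W.orthogonalProjectionOnto (Z ω)) P := by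
  refine HasGaussianLaw.indepFun_of_covariance_inner
    (hZ.hasGaussianLaw.map_fun ((innerSL ℝ a).prod W.orthogonalProjectionOnto)) fun x y ↦ ?_
  have h := hZ.covariance_fun_comp (f := fun z ↦ inner ℝ (x • a) z)
    (g := fun z ↦ inner ℝ (y : E) z) (by fun_prop) (by fun_prop)
  rw [covariance_inner_stdGaussian, real_inner_smul_left,
    Submodule.inner_left_of_mem_orthogonal y.2 ha, mul_zero] at h
  convert h using 3 with ω ω
  · simp [inner_smul_left, mul_comm]
  · exact W.inner_orthogonalProjectionOnto_eq_of_mem_left y _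

end Gaussian

/-! ### Products of independent square integrable variables -/

section IndepProducts

variable {Ω : Type*} [MeasurableSpace Ω] {P : Measure Ω}

lemma memLp_mul_of_indepFun {A B : Ω → ℝ} (h : IndepFun A B P) (hA : MemLp A 2 P)
    (hB : MemLp B 2 P) :
    MemLp (fun ω ↦ A ω * B ω) 2 P := by
  refine (memLp_two_iff_integrable_sq (hA.1.mul hB.1)).2 ?_
  convert (h.comp (φ := fun x : ℝ ↦ x ^ 2) (ψ := fun x : ℝ ↦ x ^ 2) (by fun_prop)
    (by fun_prop)).integrable_mul hA.integrable_sq hB.integrable_sq using 2 with ω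
  exact mul_pow _ _ _

lemma variance_mul_of_indepFun [IsProbabilityMeasure P] {A B : Ω → ℝ} (h : IndepFun A B P)
    (hA : MemLp A 2 P) (hB : MemLp B 2 P) :
    Var[fun ω ↦ A ω * B ω; P] = P[A ^ 2] * P[B ^ 2] - (P[A] * P[B]) ^ 2 := by
  have h2 := (h.comp (φ := fun x : ℝ ↦ x ^ 2) (ψ := fun x : ℝ ↦ x ^ 2) (by fun_prop)
    (by fun_prop)).integral_fun_mul_eq_mul_integral
    (by exact hA.1.pow 2) (by exact hB.1.pow 2)
  rw [variance_eq_sub (memLp_mul_of_indepFun h hA hB),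
    h.integral_fun_mul_eq_mul_integral hA.1 hB.1]
  congr 1
  simpa [mul_pow] using! h2

end IndepProducts

/-! ### Least squares as orthogonal projection -/

section LeastSquares

variable {n k : ℕ} (X : Matrix (Fin n) (Fin (k + 2)) ℝ)

/-- The column space of the design matrix, as a subspace of Euclidean space. -/
noncomputable def colSpace : Submodule ℝ (EuclideanSpace ℝ (Fin n)) :=
  LinearMap.range (Matrix.toLpLin 2 2 X)

variable {X}

lemma toLp_mulVec_mem_colSpace (b : Fin (k + 2) → ℝ) : WithLp.toLp 2 (X *ᵥ b) ∈ colSpace X :=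
  ⟨WithLp.toLp 2 b, rfl⟩

lemma mem_orthogonal_colSpace {z : EuclideanSpace ℝ (Fin n)} (hz : Xᵀ *ᵥ z.ofLp = 0) :
    z ∈ (colSpace X)ᗮ := by
  rw [Submodule.mem_orthogonal]
  rintro _ ⟨b, rfl⟩
  rw [EuclideanSpace.inner_eq_star_dotProduct, star_trivial, Matrix.ofLp_toLpLin,
    Matrix.toLin'_apply, Matrix.dotProduct_mulVec, ← Matrix.mulVec_transpose, hz, zero_dotProduct]

lemma finrank_orthogonal_colSpace (hX : X.rank = k + 2) :
    (Module.finrank ℝ (colSpace X)ᗮ : ℝ) = dof n k := by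
  have h1 : Module.finrank ℝ (colSpace X) = k + 2 := by
    rw [← hX, X.rank_eq_finrank_range_toLin (PiLp.basisFun 2 ℝ _) (PiLp.basisFun 2 ℝ _),
      ← Matrix.toLpLin_eq_toLin, colSpace]
  have h2 := (colSpace X).finrank_add_finrank_orthogonal
  rw [h1, finrank_euclideanSpace_fin] at h2
  have h3 := congrArg (Nat.cast : ℕ → ℝ) h2
  push_cast at h3
  rw [dof, ← h3]
  ring

lemma isUnit_transpose_mul_self (hX : X.rank = k + 2) : IsUnit (Xᵀ * X) := by
  rw [← Matrix.mulVec_surjective_iff_isUnit]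
  change Function.Surjective (Xᵀ * X).mulVecLin
  rw [← LinearMap.range_eq_top]
  refine Submodule.eq_top_of_finrank_eq ?_
  rw [Module.finrank_fin_fun]
  exact X.rank_transpose_mul_self.trans hX

lemma transpose_mul_self_mul_inv (hX : X.rank = k + 2) : Xᵀ * X * (Xᵀ * X)⁻¹ = 1 :=
  Matrix.mul_nonsing_inv _ ((Matrix.isUnit_iff_isUnit_det _).1 (isUnit_transpose_mul_self hX))

/-- The residuals are the projection of `y` on the orthogonal complement of the column space. -/
lemma toLp_residual_eq (hX : X.rank = k + 2) (y : Fin n → ℝ) :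
    WithLp.toLp 2 (y - X *ᵥ betaHat X y) =
      (colSpace X)ᗮ.starProjection (WithLp.toLp 2 y) := by
  refine (Submodule.eq_starProjection_of_mem_orthogonal (mem_orthogonal_colSpace ?_) ?_).symm
  · rw [betaHat, WithLp.ofLp_toLp, Matrix.mulVec_sub, Matrix.mulVec_mulVec, Matrix.mulVec_mulVec,
      ← Matrix.mul_assoc, transpose_mul_self_mul_inv hX, Matrix.one_mul, sub_self]
  · refine Submodule.le_orthogonal_orthogonal _ ?_
    rw [← WithLp.toLp_sub, sub_sub_cancel]
    exact toLp_mulVec_mem_colSpace _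

lemma sigmaHatSq_eq (hX : X.rank = k + 2) (β : Fin (k + 2) → ℝ) (σ : ℝ)
    (z : EuclideanSpace ℝ (Fin n)) :
    sigmaHatSq X (X *ᵥ β + σ • z.ofLp) =
      (dof n k)⁻¹ * (σ * ‖(colSpace X)ᗮ.orthogonalProjectionOnto z‖) ^ 2 := by
  set y := X *ᵥ β + σ • z.ofLp
  have h1 : WithLp.toLp 2 (y - X *ᵥ betaHat X y) = σ • (colSpace X)ᗮ.starProjection z := by
    rw [toLp_residual_eq hX, WithLp.toLp_add, map_add,
      (Submodule.starProjection_apply_eq_zero_iff _).2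
        (Submodule.le_orthogonal_orthogonal _ (toLp_mulVec_mem_colSpace β)), zero_add,
      WithLp.toLp_smul, map_smul]
  have h2 : (y - X *ᵥ betaHat X y) ⬝ᵥ (y - X *ᵥ betaHat X y) =
      ‖WithLp.toLp 2 (y - X *ᵥ betaHat X y)‖ ^ 2 := by
    rw [← real_inner_self_eq_norm_sq, EuclideanSpace.inner_eq_star_dotProduct, star_trivial]
  rw [sigmaHatSq, h2, h1, norm_smul, mul_pow, mul_pow, Real.norm_eq_abs, sq_abs]
  rfl

/-- The vector `X (X' X)⁻¹ e`, with `e` the unit vector at the position of `β₁`: the estimation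
error `β̂₁ - β₁` is its inner product with the noise. -/
noncomputable def slopeVec (X : Matrix (Fin n) (Fin (k + 2)) ℝ) :
    EuclideanSpace ℝ (Fin n) :=
  WithLp.toLp 2 (X *ᵥ ((Xᵀ * X)⁻¹ *ᵥ Pi.single 1 1))

lemma betaHat_one_eq (hX : X.rank = k + 2) (β : Fin (k + 2) → ℝ) (σ : ℝ)
    (z : EuclideanSpace ℝ (Fin n)) :
    betaHat X (X *ᵥ β + σ • z.ofLp) 1 = β 1 + σ * inner ℝ (slopeVec X) z := by
  have h1 : (Xᵀ * X)⁻¹ * (Xᵀ * X) = 1 := Matrix.nonsing_inv_mul _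
    ((Matrix.isUnit_iff_isUnit_det _).1 (isUnit_transpose_mul_self hX))
  have h2 : inner ℝ (slopeVec X) z = (((Xᵀ * X)⁻¹ * Xᵀ) *ᵥ z.ofLp) 1 := by
    rw [EuclideanSpace.inner_eq_star_dotProduct, star_trivial, slopeVec, WithLp.ofLp_toLp,
      Matrix.mulVec_mulVec, Matrix.dotProduct_mulVec, ← Matrix.mulVec_transpose,
      Matrix.transpose_mul, Matrix.transpose_nonsing_inv, Matrix.transpose_mul,
      Matrix.transpose_transpose, dotProduct_single_one]
  rw [h2, betaHat, Matrix.mulVec_add, Matrix.mulVec_mulVec, Matrix.mul_assoc, h1,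
    Matrix.one_mulVec, Matrix.mulVec_smul]
  rfl

lemma inner_slopeVec_self (hX : X.rank = k + 2) :
    inner ℝ (slopeVec X) (slopeVec X) = v1Sq X := by
  rw [EuclideanSpace.inner_eq_star_dotProduct, star_trivial, slopeVec, WithLp.ofLp_toLp,
    Matrix.dotProduct_mulVec, ← Matrix.mulVec_transpose, Matrix.mulVec_mulVec,
    Matrix.mulVec_mulVec, transpose_mul_self_mul_inv hX, Matrix.one_mulVec, v1Sq]

/-- Stated with the double complement, as the vector is used through its orthogonality to the
residual space `(colSpace X)ᗮ`. -/
lemma slopeVec_mem_orthogonal_orthogonal (X : Matrix (Fin n) (Fin (k + 2)) ℝ) :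
    slopeVec X ∈ (colSpace X)ᗮᗮ :=
  Submodule.le_orthogonal_orthogonal _ (toLp_mulVec_mem_colSpace _)

/-- If the projection of `z` vanishes, both sides are `0`, since division by `0` gives `0`. -/
lemma dHat_eq (hX : X.rank = k + 2) (β : Fin (k + 2) → ℝ) {σ : ℝ} (hσ : 0 < σ)
    (z : EuclideanSpace ℝ (Fin n)) :
    dHat X (X *ᵥ β + σ • z.ofLp) =
      √(dof n k) * ((effectSize β σ + inner ℝ (slopeVec X) z) *
        ‖(colSpace X)ᗮ.orthogonalProjectionOnto z‖⁻¹) := by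
  rw [dHat, betaHat_one_eq hX, sigmaHatSq_eq hX, Real.sqrt_mul' _ (sq_nonneg _),
    Real.sqrt_sq (by positivity), Real.sqrt_inv, effectSize]
  field_simp

end LeastSquares

/-! ### Moments of the estimator -/

lemma hasLaw_inv_smul_stdGaussian {Ω ι : Type*} [MeasurableSpace Ω] {P : Measure Ω} [Fintype ι]
    [DecidableEq ι] {σ : ℝ} (hσ : σ ≠ 0) {ε : Ω → EuclideanSpace ℝ ι}
    (hε : HasLaw ε (multivariateGaussian 0 (σ ^ 2 • (1 : Matrix ι ι ℝ))) P) :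
    HasLaw (fun ω ↦ σ⁻¹ • ε ω) (stdGaussian (EuclideanSpace ℝ ι)) P := by
  refine HasLaw.fun_comp (Y := (σ⁻¹ • ·)) ⟨by fun_prop, ?_⟩ hε
  rw [multivariateGaussian_zero_smul_one, Measure.map_map (by fun_prop) (by fun_prop)]
  simp [Function.comp_def, smul_smul, hσ]

end CohenD

theorem proposition2 {Ω : Type*} [MeasurableSpace Ω] (P : Measure Ω) [IsProbabilityMeasure P]
    (n k : ℕ) (hm : 2 < CohenD.dof n k)
    (X : Matrix (Fin n) (Fin (k + 2)) ℝ) (hX : X.rank = k + 2)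
    (β : Fin (k + 2) → ℝ) (σ : ℝ) (hσ : 0 < σ)
    (ε : Ω → EuclideanSpace ℝ (Fin n))
    (hε : HasLaw ε (multivariateGaussian 0 (σ ^ 2 • (1 : Matrix (Fin n) (Fin n) ℝ))) P)
    (Y : Ω → Fin n → ℝ) (hY : ∀ ω, Y ω = X *ᵥ β + (ε ω).ofLp) :
    MemLp (fun ω => CohenD.dHat X (Y ω)) 2 P ∧
    ∫ ω, CohenD.dHat X (Y ω) ∂P = CohenD.c (CohenD.dof n k) * CohenD.effectSize β σ ∧
    variance (fun ω => CohenD.dHat X (Y ω)) P =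
      CohenD.dof n k / (CohenD.dof n k - 2) * CohenD.v1Sq X +
        (CohenD.dof n k / (CohenD.dof n k - 2) - CohenD.c (CohenD.dof n k) ^ 2) *
          CohenD.effectSize β σ ^ 2 := by
  set Z : Ω → EuclideanSpace ℝ (Fin n) := fun ω ↦ σ⁻¹ • ε ω
  set W := (CohenD.colSpace X)ᗮ
  set s := CohenD.slopeVec X
  set d := CohenD.effectSize β σ
  have hZ : HasLaw Z (stdGaussian _) P := CohenD.hasLaw_inv_smul_stdGaussian hσ.ne' hε
  have hdim : (Module.finrank ℝ W : ℝ) = CohenD.dof n k := CohenD.finrank_orthogonal_colSpace hX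
  have hdim2 : 2 < Module.finrank ℝ W := by exact_mod_cast hdim ▸ hm
  set N : Ω → ℝ := fun ω ↦ inner ℝ s (Z ω)
  set A : Ω → ℝ := fun ω ↦ d + N ω
  set B : Ω → ℝ := fun ω ↦ ‖W.orthogonalProjectionOnto (Z ω)‖⁻¹
  have hd : (fun ω ↦ CohenD.dHat X (Y ω)) = fun ω ↦ √(CohenD.dof n k) * (A ω * B ω) := by
    ext ω
    rw [← CohenD.dHat_eq hX β hσ, ← WithLp.ofLp_smul, smul_inv_smul₀ hσ.ne', hY]
  have hR : HasLaw (fun ω ↦ W.orthogonalProjectionOnto (Z ω)) (stdGaussian W) P :=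
    HasLaw.fun_comp ⟨by fun_prop, CohenD.stdGaussian_map_orthogonalProjectionOnto W⟩ hZ
  -- `s` lies in the column space and is thus orthogonal to the residual space `W`.
  have hAB : IndepFun A B P :=
    (CohenD.indepFun_inner_orthogonalProjectionOnto hZ W
      (CohenD.slopeVec_mem_orthogonal_orthogonal X)).comp
      (φ := fun x ↦ d + x) (ψ := fun r : W ↦ ‖r‖⁻¹) (by fun_prop) (by fun_prop)
  have hN2 : MemLp N 2 P := (hZ.hasGaussianLaw.map_fun (innerSL ℝ s)).memLp_two
  have hA2 : MemLp A 2 P := (memLp_const d).add hN2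
  have hB2 : MemLp B 2 P :=
    (hR.map_eq ▸ CohenD.memLp_inv_norm_stdGaussian hdim2).comp_of_map hR.aemeasurable
  have hN : ∫ ω, N ω ∂P = 0 :=
    (hZ.integral_comp (f := fun z ↦ inner ℝ s z) (by fun_prop)).trans
      (CohenD.integral_inner_stdGaussian s)
  have hA : P[A] = d := by
    rw [integral_add (integrable_const d) (hN2.integrable one_le_two), hN]
    simp
  have hvar : Var[A; P] = CohenD.v1Sq X := by
    rw [variance_const_add hN2.1, ← covariance_self hN2.1.aemeasurable,
      ← CohenD.inner_slopeVec_self hX, ← CohenD.covariance_inner_stdGaussian]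
    exact hZ.covariance_fun_comp (by fun_prop) (by fun_prop)
  have hAsq : P[A ^ 2] = CohenD.v1Sq X + d ^ 2 := by
    rw [← hvar, variance_eq_sub hA2, hA, sub_add_cancel]
  have hB : √(CohenD.dof n k) * P[B] = CohenD.c (CohenD.dof n k) := by
    rw [← hdim, ← CohenD.sqrt_mul_integral_inv_norm_stdGaussian hdim2]
    congr 1
    exact hR.integral_comp (f := fun r ↦ ‖r‖⁻¹) (by fun_prop)
  have hBsq : P[B ^ 2] = (CohenD.dof n k - 2)⁻¹ := by
    rw [← hdim, ← CohenD.integral_inv_norm_sq_stdGaussian hdim2]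
    exact hR.integral_comp (f := fun r ↦ ‖r‖⁻¹ ^ 2) (by fun_prop)
  have hsq : √(CohenD.dof n k) ^ 2 = CohenD.dof n k := Real.sq_sqrt (by linarith)
  rw [hd]
  refine ⟨(CohenD.memLp_mul_of_indepFun hAB hA2 hB2).const_mul _, ?_, ?_⟩
  · rw [integral_const_mul, hAB.integral_fun_mul_eq_mul_integral hA2.1 hB2.1, hA, ← hB]
    ring
  · rw [variance_const_mul, CohenD.variance_mul_of_indepFun hAB hA2 hB2, hAsq, hBsq, hA, ← hB,
      mul_pow √(CohenD.dof n k) (P[B]), hsq]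
    ring
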